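/- Let $\mathcal M=(S,A,T,R,\beta)$ be a Markov decision process with finite state space $S$, finite nonempty sets $A(s)\subseteq A$ of available actions, transition probabilities $T(s'|s,a)$, real rewards $R(s,a,s')$ and initial distribution $\beta$, together with finitely many steady-state specifications $(L_i,[l_i,u_i])$, $L_i\subseteq S$. Write $R(s,a)=\sum_{s'}T(s'|s,a)R(s,a,s')$. The transition graph of $\mathcal M$ has an edge $s\to s'$ if $T(s'|s,a)>0$ for some $a\in A(s)$; that of a Markov chain has an edge $s\to s'$ if the transition probability from $s$ to $s'$ is positive. A terminal strongly connected component (TSCC) is a strongly connected component of the graph that is reachable from some $s$ with $\beta_s>0$ and has no edge leaving it. Let $r(\mathcal M)$ be the union of the TSCCs of $\mathcal M$ and, for a stationary policy $\pi$ (with $\pi(\cdot|s)$ a probability distribution on $A(s)$), let $r(\mathcal M_\pi)$ be the union of the TSCCs of the Markov chain $\mathcal M_\pi$ with transition probabilities $T_\pi(s'|s)=\sum_{a\in A(s)}T(s'|s,a)\pi(a|s)$ and initial distribution $\beta$. For $\delta>0$ put $$\Pi_{EP}(\delta)=\{\pi \text{ stationary}: r(\mathcal M_\pi)=r(\mathcal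 M),\ \pi(a|s)\ge\delta\ \ \forall s\in r(\mathcal M),\,a\in A(s)\}.$$ With $S_0\sim\beta$ and actions drawn from $\pi$, let $\mathrm{Pr}^\infty_\pi(s,a)=\lim_n\frac1n\sum_{t=1}^n\Pr(S_t=s,A_t=a)$ and $R^\infty_\pi(\beta)=\liminf_n\frac1n\sum_{t=1}^n\mathbb E[R(S_t,A_t)]$. The policy $\pi$ meets the specifications if $l_i\le\sum_{s\in L_i}\sum_{a\in A(s)}\mathrm{Pr}^\infty_\pi(s,a)\le u_i$ for all $i$. The linear program $\mathrm{LP}_1(\delta)$ maximizes $\sum_{s}\sum_{a\in A(s)}x_{sa}R(s,a)$ over $x_{sa}\in[0,1]$, $y_{sa}\ge0$ ($s\in S$, $a\in A(s)$) subject to $$\sum_{s}\sum_{a\in A(s)}x_{sa}T(s'|s,a)=\sum_{a\in A(s')}x_{s'a},\qquad \sum_{s}\sum_{a\in A(s)}y_{sa}T(s'|s,a)=\sum_{a\in A(s')}(x_{s'a}+y_{s'a})-\beta_{s'}\qquad(s'\in S),$$ $$\sum_{f\notin r(\mathcal M)}\sum_{a\in A(f)}x_{fa}=0,\qquad l_i\le\sum_{s\in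 L_i}\sum_{a\in A(s)}x_{sa}\le u_i\ \ \forall i,\qquad x_{sa}\ge\delta\ \ \forall s\in r(\mathcal M),\,a\in A(s).$$ A policy derived from a feasible point $(x,y)$ is any stationary policy $\pi$ such that, with $x_s=\sum_{a\in A(s)}x_{sa}$ and $y_s=\sum_{a\in A(s)}y_{sa}$, one has $\pi(a|s)=x_{sa}/x_s$ if $x_s>0$, and $\pi(a|s)=y_{sa}/y_s$ if $x_s=0$ and $y_s>0$ ($\pi(\cdot|s)$ is arbitrary otherwise). Then: 1. For every $\delta>0$, every policy derived from a feasible solution of $\mathrm{LP}_1(\delta)$ belongs to $\Pi_{EP}(\delta)$. 2. Suppose that, for all sufficiently small $\delta>0$, $(x^*_\delta,y^*_\delta)$ is an optimal solution of $\mathrm{LP}_1(\delta)$ and $\pi^*_\delta$ is a policy derived from it, and let $R^*(\delta)=R^\infty_{\pi^*_\delta}(\beta)$. Then for all sufficiently small $\delta>0$ the set $\{R^\infty_\pi(\beta):\pi\in\Pi_{EP}(\delta),\ \pi\text{ meets the specifications}\}$ is nonempty and bounded above, and $$\lim_{\delta\to0^+}\Big(\sup\{R^\infty_\pi(\beta):\pi\in\Pi_{EP}(\delta),\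 \pi\text{ meets the specifications}\}-R^*(\delta)\Big)=0.$$ -/

import Mathlib

open Filter Topology

/-- Finite-state Markov decision process. `avail s` is the finite nonempty set `A(s)` of actions
available at `s`, `trans s a s'` is `T(s' | s, a)`, `reward s a s'` is `R(s, a, s')` and `init` is
the initial distribution `β`. Values at unavailable actions play no role. -/
structure MDP (S A : Type*) [Fintype S] where
  avail : S → Finset A
  avail_nonempty : ∀ s, (avail s).Nonempty
  trans : S → A → S → ℝ
  trans_nonneg : ∀ s, ∀ a ∈ avail s, ∀ s', 0 ≤ trans s a s'
  trans_sum : ∀ s, ∀ a ∈ avail s, ∑ s', trans s a s' = 1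
  reward : S → A → S → ℝ
  init : S → ℝ
  init_nonneg : ∀ s, 0 ≤ init s
  init_sum : ∑ s, init s = 1

/-- Labeled MDP: an MDP with finitely many steady-state specifications `(L_i, [l_i, u_i])`. -/
structure LMDP (S A : Type*) [Fintype S] extends MDP S A where
  numSpecs : ℕ
  label : Fin numSpecs → Finset S
  lower : Fin numSpecs → ℝ
  upper : Fin numSpecs → ℝ

/-! ### Terminal strongly connected components -/

section Digraph

variable {S : Type*}

/-- Strongly connected component of the digraph `E`: a maximal set of vertices any two of which
are joined by directed paths (possibly of length zero) in both directions. -/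
def IsSCC (E : S → S → Prop) (C : Set S) : Prop :=
  Maximal (fun D : Set S => ∀ s ∈ D, ∀ s' ∈ D, Relation.ReflTransGen E s s') C

/-- Terminal strongly connected component, relative to an initial distribution `β`: an SCC that is
reachable from some state with `β s > 0` and has no edge leaving it. -/
def IsTSCC (E : S → S → Prop) (β : S → ℝ) (C : Set S) : Prop :=
  IsSCC E C ∧
  (∃ s, 0 < β s ∧ ∃ s' ∈ C, Relation.ReflTransGen E s s') ∧
  (∀ s ∈ C, ∀ s', E s s' → s' ∈ C)

/-- The union `r` of all terminal strongly connected components. -/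
def tsccUnion (E : S → S → Prop) (β : S → ℝ) : Set S :=
  {s | ∃ C, IsTSCC E β C ∧ s ∈ C}

end Digraph

namespace MDP

variable {S A : Type*} [Fintype S]

/-- Edges of the transition graph of the MDP. -/
def Edge (M : MDP S A) (s s' : S) : Prop := ∃ a ∈ M.avail s, 0 < M.trans s a s'

/-- `r(M)`: the union of the TSCCs of the MDP. -/
def recurrentSet (M : MDP S A) : Set S := tsccUnion M.Edge M.init

/-- Stationary policies: `π s a` is `π(a | s)`, a probability distribution on `A(s)`. -/
structure IsStationaryPolicy (M : MDP S A) (π : S → A → ℝ) : Prop where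
  nonneg : ∀ s a, 0 ≤ π s a
  support : ∀ s, ∀ a ∉ M.avail s, π s a = 0
  sum_eq_one : ∀ s, ∑ a ∈ M.avail s, π s a = 1

/-- Transition probabilities `T_π(s' | s)` of the Markov chain induced by `π`. -/
def chainTrans (M : MDP S A) (π : S → A → ℝ) (s s' : S) : ℝ :=
  ∑ a ∈ M.avail s, M.trans s a s' * π s a

/-- `r(M_π)`: the union of the TSCCs of the Markov chain induced by `π`. -/
def recurrentSetOf (M : MDP S A) (π : S → A → ℝ) : Set S :=
  tsccUnion (fun s s' => 0 < M.chainTrans π s s') M.init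

/-- Edge-preserving policies. -/
def edgePreserving (M : MDP S A) : Set (S → A → ℝ) :=
  {π | M.IsStationaryPolicy π ∧ M.recurrentSetOf π = M.recurrentSet ∧
    ∀ s ∈ M.recurrentSet, ∀ a ∈ M.avail s, 0 < π s a}

/-- Edge-preserving policies of support bounded below by `δ`. -/
def edgePreservingBdd (M : MDP S A) (δ : ℝ) : Set (S → A → ℝ) :=
  {π | M.IsStationaryPolicy π ∧ M.recurrentSetOf π = M.recurrentSet ∧
    ∀ s ∈ M.recurrentSet, ∀ a ∈ M.avail s, δ ≤ π s a}

/-! ### Steady-state distribution and average reward -/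

/-- `Pr(S_t = s | β, π)`, with `S_0 ∼ β`. -/
def stateProb (M : MDP S A) (π : S → A → ℝ) : ℕ → S → ℝ
  | 0 => M.init
  | t + 1 => fun s' => ∑ s, M.stateProb π t s * M.chainTrans π s s'

/-- `Pr(S_t = s, A_t = a | β, π)`. -/
def stateActionProb (M : MDP S A) (π : S → A → ℝ) (t : ℕ) (s : S) (a : A) : ℝ :=
  M.stateProb π t s * π s a

/-- `p` is the steady-state distribution (occupation measure) `Pr^∞_π` on the available
state-action pairs: the limit of the time averages exists and equals `p`. -/
def IsSteadyState (M : MDP S A) (π p : S → A → ℝ) : Prop :=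
  ∀ s, ∀ a ∈ M.avail s,
    Tendsto (fun n : ℕ => (1 / (n : ℝ)) * ∑ t ∈ Finset.Icc 1 n, M.stateActionProb π t s a)
      atTop (𝓝 (p s a))

/-- `R(s, a) = ∑ s', T(s' | s, a) R(s, a, s')`. -/
def meanReward (M : MDP S A) (s : S) (a : A) : ℝ :=
  ∑ s', M.trans s a s' * M.reward s a s'

/-- `E[R(S_t, A_t)]` under `π` and `β`. -/
def expReward (M : MDP S A) (π : S → A → ℝ) (t : ℕ) : ℝ :=
  ∑ s, ∑ a ∈ M.avail s, M.stateActionProb π t s a * M.meanReward s a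

/-- Expected average reward `R^∞_π(β)`. -/
noncomputable def avgReward (M : MDP S A) (π : S → A → ℝ) : ℝ :=
  liminf (fun n : ℕ => (1 / (n : ℝ)) * ∑ t ∈ Finset.Icc 1 n, M.expReward π t) atTop

/-! ### The linear program -/

open Classical in
/-- The constraint set `Q_0`. -/
structure InQ0 (M : MDP S A) (x y : S → A → ℝ) : Prop where
  stationary : ∀ s', ∑ s, ∑ a ∈ M.avail s, x s a * M.trans s a s' = ∑ a ∈ M.avail s', x s' a
  flow : ∀ s', ∑ s, ∑ a ∈ M.avail s, y s a * M.trans s a s' =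
    ∑ a ∈ M.avail s', (x s' a + y s' a) - M.init s'
  nonrecurrent : ∑ f ∈ Finset.univ.filter (fun f => f ∉ M.recurrentSet),
    ∑ a ∈ M.avail f, x f a = 0
  x_mem : ∀ s, ∀ a ∈ M.avail s, x s a ∈ Set.Icc (0 : ℝ) 1
  y_nonneg : ∀ s, ∀ a ∈ M.avail s, 0 ≤ y s a

/-- The objective `∑ x_{sa} R(s, a)`. -/
def lpObjective (M : MDP S A) (x : S → A → ℝ) : ℝ :=
  ∑ s, ∑ a ∈ M.avail s, x s a * M.meanReward s a

/-- `π` is a policy obtained from `(x, y)`: `π(a|s) = x_{sa}/x_s` where `x_s > 0`,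
`π(a|s) = y_{sa}/y_s` where `x_s` is not positive but `y_s > 0`, and arbitrary elsewhere. -/
structure IsPolicyFrom (M : MDP S A) (x y π : S → A → ℝ) : Prop where
  stationaryPolicy : M.IsStationaryPolicy π
  eq_x : ∀ s, 0 < ∑ b ∈ M.avail s, x s b →
    ∀ a ∈ M.avail s, π s a = x s a / ∑ b ∈ M.avail s, x s b
  eq_y : ∀ s, ¬ 0 < ∑ b ∈ M.avail s, x s b → 0 < ∑ b ∈ M.avail s, y s b →
    ∀ a ∈ M.avail s, π s a = y s a / ∑ b ∈ M.avail s, y s b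

end MDP

namespace LMDP

variable {S A : Type*} [Fintype S]

/-- The chain induced by `π` meets every steady-state specification. -/
def MeetsSpecs (M : LMDP S A) (π : S → A → ℝ) : Prop :=
  ∃ p : S → A → ℝ, M.IsSteadyState π p ∧
    ∀ i, ∑ s ∈ M.label i, ∑ a ∈ M.avail s, p s a ∈ Set.Icc (M.lower i) (M.upper i)

/-- Feasible points of `LP_1(δ)`. -/
structure IsFeasible (M : LMDP S A) (δ : ℝ) (x y : S → A → ℝ) : Prop where
  inQ0 : M.InQ0 x y
  specs : ∀ i, ∑ s ∈ M.label i, ∑ a ∈ M.avail s, x s a ∈ Set.Icc (M.lower i) (M.upper i)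
  bounded : ∀ s ∈ M.recurrentSet, ∀ a ∈ M.avail s, δ ≤ x s a

/-- Optimal solutions of `LP_1(δ)`. -/
def IsOptimal (M : LMDP S A) (δ : ℝ) (x y : S → A → ℝ) : Prop :=
  M.IsFeasible δ x y ∧ ∀ x' y', M.IsFeasible δ x' y' → M.lpObjective x' ≤ M.lpObjective x

/-- The average rewards of the policies in `Π_EP(δ)` that meet the specifications. -/
def admissibleRewards (M : LMDP S A) (δ : ℝ) : Set ℝ :=
  M.avgReward '' {π | π ∈ M.edgePreservingBdd δ ∧ M.MeetsSpecs π}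

end LMDP

/-! The argument is a dictionary between points of the linear program and occupation measures of
edge-preserving policies.

From the program to policies: if `x` is positive on r(M), a policy derived from `(x, y)` has `x` as
its occupation measure (`MDP.InQ0.isSteadyState`). The constraints on `x` make it stationary.
Several stationary distributions may exist when there are several components, and `y` selects the
right one: outside r(M) it bounds the expected numbers of visits, so no component receives more mass
than `x` gives it, and equality of total mass does the rest
(`IsMarkovChain.tendsto_timeAvg_of_flow`). Since limiting time averages charge exactly the recurrent
states (`IsMarkovChain.limit_pos_iff`), item 1 follows.

From policies to the program: an occupation measure `p` gets its `y` from a nonnegative solution of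
y - yP = β - p (`IsMarkovChain.exists_nonneg_potential`). The bound π ≥ δ only gives p ≥ cδ with c
depending on π, so an admissible policy is feasible for a smaller parameter. Item 2 survives because
optimal values increase as δ decreases: they and the suprema are squeezed towards the same limit. -/

/-! ### Terminal components as recurrent reachable states -/

section Digraph

variable {S : Type*}

/-- A state lies in a terminal component iff it is reachable from the initial distribution and
every state it can reach can reach it back. -/
theorem mem_tsccUnion_iff {E : S → S → Prop} {β : S → ℝ} {s : S} :
    s ∈ tsccUnion E β ↔ (∃ s₀, 0 < β s₀ ∧ Relation.ReflTransGen E s₀ s) ∧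
      ∀ s', Relation.ReflTransGen E s s' → Relation.ReflTransGen E s' s := by
  constructor
  · rintro ⟨C, ⟨hC, ⟨s₀, h0, s₁, h1, h01⟩, hcl⟩, hs⟩
    refine ⟨⟨s₀, h0, h01.trans (hC.prop _ h1 _ hs)⟩, fun s' h => ?_⟩
    have : s' ∈ C := by
      induction h with
      | refl => exact hs
      | tail _ hE ih => exact hcl _ ih _ hE
    exact hC.prop _ this _ hs
  · rintro ⟨⟨s₀, h0, h01⟩, hrec⟩
    refine ⟨{t | Relation.ReflTransGen E s t}, ⟨⟨?_, ?_⟩, ⟨s₀, h0, s, .refl, h01⟩, ?_⟩, .refl⟩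
    · exact fun t ht u hu => (hrec t ht).trans hu
    · exact fun D hD hle d hd => hD _ (hle Relation.ReflTransGen.refl) _ hd
    · exact fun t ht u htu => ht.tail htu

theorem mem_tsccUnion_of_reflTransGen {E : S → S → Prop} {β : S → ℝ} {s t : S}
    (hs : s ∈ tsccUnion E β) (h : Relation.ReflTransGen E s t) : t ∈ tsccUnion E β := by
  rw [mem_tsccUnion_iff] at hs ⊢
  obtain ⟨⟨s₀, h0, h01⟩, hrec⟩ := hs
  exact ⟨⟨s₀, h0, h01.trans h⟩, fun u hu => (hrec u (h.trans hu)).trans h⟩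

/-- Among the states reachable from `s`, take one with the fewest descendants: any descendant of it
has the same descendants, hence leads back. -/
theorem exists_reflTransGen_mem_tsccUnion [Finite S] {E : S → S → Prop} {β : S → ℝ} {s₀ s : S}
    (h0 : 0 < β s₀) (h : Relation.ReflTransGen E s₀ s) :
    ∃ t ∈ tsccUnion E β, Relation.ReflTransGen E s t := by
  obtain ⟨t, hst, hmin⟩ := Set.exists_min_image {t | Relation.ReflTransGen E s t}
    (fun t => {u | Relation.ReflTransGen E t u}.ncard) (Set.toFinite _)
    ⟨s, Relation.ReflTransGen.refl⟩
  refine ⟨t, mem_tsccUnion_iff.2 ⟨⟨s₀, h0, h.trans hst⟩, fun u htu => ?_⟩, hst⟩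
  have heq := Set.eq_of_subset_of_ncard_le
    (s := {v | Relation.ReflTransGen E u v}) (t := {v | Relation.ReflTransGen E t v})
    (fun v hv => htu.trans hv) (hmin u (hst.trans htu)) (Set.toFinite _)
  have : t ∈ {v | Relation.ReflTransGen E t v} := Relation.ReflTransGen.refl
  rwa [← heq] at this

end Digraph

/-! ### Finite Markov chains -/

/-- `P` is a stochastic matrix and `β` a probability vector. -/
structure IsMarkovChain {S : Type*} [Fintype S] (P : S → S → ℝ) (β : S → ℝ) : Prop where
  nonneg : ∀ s s', 0 ≤ P s s'
  row_sum : ∀ s, ∑ s', P s s' = 1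
  init_nonneg : ∀ s, 0 ≤ β s
  init_sum : ∑ s, β s = 1

namespace IsMarkovChain

variable {S : Type*} [Fintype S]

/-- The row vector `v P`. -/
def push (P : S → S → ℝ) : (S → ℝ) →ₗ[ℝ] (S → ℝ) where
  toFun v s' := ∑ s, v s * P s s'
  map_add' u v := by ext s'; simp [add_mul, Finset.sum_add_distrib]
  map_smul' c v := by ext s'; simp [mul_assoc, Finset.mul_sum]

theorem push_apply (P : S → S → ℝ) (v : S → ℝ) (s' : S) : push P v s' = ∑ s, v s * P s s' := rfl

/-- The law of the chain at time `t`. -/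
def law (P : S → S → ℝ) (β : S → ℝ) (t : ℕ) : S → ℝ := (push P)^[t] β

/-- The time average of the laws at times `1, …, n`. -/
noncomputable def timeAvg (P : S → S → ℝ) (β : S → ℝ) (n : ℕ) : S → ℝ :=
  fun s => (1 / (n : ℝ)) * ∑ t ∈ Finset.Icc 1 n, law P β t s

@[simp] theorem law_zero (P : S → S → ℝ) (β : S → ℝ) : law P β 0 = β := rfl

theorem law_succ (P : S → S → ℝ) (β : S → ℝ) (t : ℕ) : law P β (t + 1) = push P (law P β t) :=
  Function.iterate_succ_apply' _ _ _

variable {P : S → S → ℝ} {β : S → ℝ}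

theorem push_nonneg (h : IsMarkovChain P β) {v : S → ℝ} (hv : ∀ s, 0 ≤ v s) (s : S) :
    0 ≤ push P v s :=
  Finset.sum_nonneg fun _ _ => mul_nonneg (hv _) (h.nonneg _ _)

theorem sum_push (h : IsMarkovChain P β) (v : S → ℝ) : ∑ s, push P v s = ∑ s, v s := by
  simp only [push_apply]
  rw [Finset.sum_comm]
  simp [← Finset.mul_sum, h.row_sum]

theorem law_nonneg (h : IsMarkovChain P β) (t : ℕ) : ∀ s, 0 ≤ law P β t s := by
  induction t with
  | zero => exact h.init_nonneg
  | succ t ih => rw [law_succ]; exact h.push_nonneg ih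

theorem sum_law (h : IsMarkovChain P β) (t : ℕ) : ∑ s, law P β t s = 1 := by
  induction t with
  | zero => exact h.init_sum
  | succ t ih => rw [law_succ, h.sum_push, ih]

theorem law_le_one (h : IsMarkovChain P β) (t : ℕ) (s : S) : law P β t s ≤ 1 :=
  (Finset.single_le_sum (fun i _ => h.law_nonneg t i) (Finset.mem_univ s)).trans_eq (h.sum_law t)

theorem exists_reflTransGen_of_law_pos (h : IsMarkovChain P β) {t : ℕ} {s : S}
    (hs : 0 < law P β t s) :
    ∃ s₀, 0 < β s₀ ∧ Relation.ReflTransGen (fun s s' => 0 < P s s') s₀ s := by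
  induction t generalizing s with
  | zero => exact ⟨s, hs, .refl⟩
  | succ t ih =>
    rw [law_succ, push_apply] at hs
    obtain ⟨u, -, hu⟩ := Finset.exists_lt_of_sum_lt
      (s := Finset.univ) (f := fun _ : S => (0 : ℝ)) (by simpa using hs)
    have hu1 : 0 < law P β t u := (h.law_nonneg t u).lt_of_ne' fun e => by simp [e] at hu
    have hu2 : 0 < P u s := (h.nonneg u s).lt_of_ne' fun e => by simp [e] at hu
    obtain ⟨s₀, h0, h1⟩ := ih hu1
    exact ⟨s₀, h0, h1.tail hu2⟩

theorem exists_law_pos_of_reflTransGen (h : IsMarkovChain P β) {s₀ s : S} (h0 : 0 < β s₀)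
    (hs : Relation.ReflTransGen (fun s s' => 0 < P s s') s₀ s) : ∃ t, 0 < law P β t s := by
  induction hs with
  | refl => exact ⟨0, h0⟩
  | @tail u v _ huv ih =>
    obtain ⟨t, ht⟩ := ih
    refine ⟨t + 1, ?_⟩
    rw [law_succ, push_apply]
    exact (mul_pos ht huv).trans_le (Finset.single_le_sum
      (f := fun s => law P β t s * P s v)
      (fun i _ => mul_nonneg (h.law_nonneg t i) (h.nonneg _ _)) (Finset.mem_univ u))

theorem sum_timeAvg (P : S → S → ℝ) (β : S → ℝ) (C : Finset S) (n : ℕ) :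
    ∑ s ∈ C, timeAvg P β n s = (1 / (n : ℝ)) * ∑ t ∈ Finset.Icc 1 n, ∑ s ∈ C, law P β t s := by
  simp only [timeAvg]
  rw [← Finset.mul_sum, Finset.sum_comm]

theorem timeAvg_nonneg (h : IsMarkovChain P β) (n : ℕ) (s : S) : 0 ≤ timeAvg P β n s :=
  mul_nonneg (by positivity) (Finset.sum_nonneg fun _ _ => h.law_nonneg _ _)

/-- Bound on a time average from a bound on each term. -/
theorem average_le {f : ℕ → ℝ} {c : ℝ} {n : ℕ} (hn : 1 ≤ n) (hf : ∀ t, f t ≤ c) :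
    (1 / (n : ℝ)) * ∑ t ∈ Finset.Icc 1 n, f t ≤ c := by
  have hn' : (0 : ℝ) < n := by exact_mod_cast hn
  have := Finset.sum_le_card_nsmul (Finset.Icc 1 n) f c (fun t _ => hf t)
  rw [Nat.card_Icc, nsmul_eq_mul, Nat.add_sub_cancel] at this
  rw [one_div, inv_mul_le_iff₀ hn']
  exact this

theorem sum_timeAvg_univ (h : IsMarkovChain P β) {n : ℕ} (hn : 1 ≤ n) :
    ∑ s, timeAvg P β n s = 1 := by
  have hn' : (n : ℝ) ≠ 0 := by positivity
  rw [sum_timeAvg]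
  simp [h.sum_law, hn']

theorem timeAvg_le_one (h : IsMarkovChain P β) {n : ℕ} (hn : 1 ≤ n) (s : S) :
    timeAvg P β n s ≤ 1 :=
  average_le hn fun t => h.law_le_one t s

/-- Shifting the averaging window by one telescopes; the O(1/n) error is what makes limits
invariant. -/
theorem push_timeAvg (P : S → S → ℝ) (β : S → ℝ) (n : ℕ) (s : S) :
    push P (timeAvg P β n) s =
      timeAvg P β n s + (1 / (n : ℝ)) * (law P β (n + 1) s - law P β 1 s) := by
  have h1 : push P (timeAvg P β n) s =
      (1 / (n : ℝ)) * ∑ t ∈ Finset.Icc 1 n, law P β (t + 1) s := by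
    simp only [law_succ, push_apply, timeAvg, mul_assoc, Finset.mul_sum, Finset.sum_mul]
    exact Finset.sum_comm
  have h2 : ∀ m : ℕ, ∑ t ∈ Finset.Icc 1 m, law P β (t + 1) s =
      ∑ t ∈ Finset.Icc 1 m, law P β t s + (law P β (m + 1) s - law P β 1 s) := fun m => by
    induction m with
    | zero => simp
    | succ m ih =>
      rw [Finset.sum_Icc_succ_top (by omega), Finset.sum_Icc_succ_top (by omega), ih]
      ring
  rw [h1, h2, mul_add, timeAvg]

/-- A limit of time averages along a filter is a stationary distribution. -/
theorem stationary_of_tendsto (h : IsMarkovChain P β) {l : Filter ℕ} [l.NeBot] (hl : l ≤ atTop)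
    {q : S → ℝ} (hq : Tendsto (timeAvg P β) l (𝓝 q)) :
    push P q = q ∧ (∀ s, 0 ≤ q s) ∧ ∑ s, q s = 1 := by
  have hq' := tendsto_pi_nhds.1 hq
  refine ⟨funext fun s => ?_, fun s => ?_, ?_⟩
  · have h1 : Tendsto (fun n => push P (timeAvg P β n) s) l (𝓝 (push P q s)) :=
      tendsto_finsetSum _ fun u _ => (hq' u).mul_const _
    have h2 : Tendsto (fun n : ℕ => (1 / (n : ℝ)) * (law P β (n + 1) s - law P β 1 s)) l (𝓝 0) := by
      refine squeeze_zero_norm (a := fun n : ℕ => 1 / (n : ℝ)) (fun n => ?_)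
        (tendsto_one_div_atTop_nhds_zero_nat.mono_left hl)
      rw [norm_mul, Real.norm_of_nonneg (by positivity : (0 : ℝ) ≤ 1 / (n : ℝ))]
      refine mul_le_of_le_one_right (by positivity) ?_
      rw [Real.norm_eq_abs, abs_le]
      constructor <;> linarith [h.law_nonneg (n + 1) s, h.law_nonneg 1 s, h.law_le_one (n + 1) s,
        h.law_le_one 1 s]
    have h3 := (hq' s).add h2
    rw [add_zero] at h3
    simp only [← push_timeAvg] at h3
    exact tendsto_nhds_unique h1 h3
  · exact ge_of_tendsto' (hq' s) fun n => h.timeAvg_nonneg n s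
  · refine tendsto_nhds_unique (tendsto_finsetSum _ fun s _ => hq' s) ?_
    refine tendsto_const_nhds.congr' ?_
    filter_upwards [hl (eventually_ge_atTop 1)] with n hn using (h.sum_timeAvg_univ hn).symm

/-- A subinvariant vector is invariant. -/
theorem push_eq_of_le (h : IsMarkovChain P β) {v : S → ℝ} (hv : ∀ s, v s ≤ push P v s) :
    push P v = v :=
  -- Pushing preserves total mass, so a termwise inequality must be an equality.
  funext fun s => (((Finset.sum_eq_sum_iff_of_le fun i _ => hv i).1 (h.sum_push v).symm) s
    (Finset.mem_univ s)).symm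

theorem pos_of_reflTransGen (h : IsMarkovChain P β) {q : S → ℝ} (hq : push P q = q)
    (hq0 : ∀ s, 0 ≤ q s) {s s' : S} (hs : 0 < q s)
    (hss : Relation.ReflTransGen (fun s s' => 0 < P s s') s s') : 0 < q s' := by
  induction hss with
  | refl => exact hs
  | @tail u v _ huv ih =>
    rw [← hq, push_apply]
    exact (mul_pos ih huv).trans_le (Finset.single_le_sum (f := fun s => q s * P s v)
      (fun i _ => mul_nonneg (hq0 i) (h.nonneg _ _)) (Finset.mem_univ u))

/-- An invariant measure does not charge states outside a closed set from which the set can be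
reached. -/
theorem mem_of_reflTransGen (h : IsMarkovChain P β) {q : S → ℝ} (hq : push P q = q)
    (hq0 : ∀ s, 0 ≤ q s) {D : Set S} (hD : ∀ s ∈ D, ∀ s', 0 < P s s' → s' ∈ D) {s s' : S}
    (hs : 0 < q s) (hss : Relation.ReflTransGen (fun s s' => 0 < P s s') s s') (hs' : s' ∈ D) :
    s ∈ D := by
  classical
  -- No mass leaves `D`, so the part of `q` outside `D` is itself invariant. Its positivity would
  -- spread along the path into `D`, where it vanishes.
  set v : S → ℝ := fun s => if s ∈ D then 0 else q s with hv
  have hv0 : ∀ s, 0 ≤ v s := fun s => by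
    simp only [hv]; split_ifs
    exacts [le_rfl, hq0 s]
  have hpv : push P v = v := h.push_eq_of_le fun t => by
    by_cases ht : t ∈ D
    · simpa [hv, ht] using h.push_nonneg hv0 t
    · refine (le_of_eq ?_ : v t ≤ push P v t)
      simp only [hv, ht, if_false]
      conv_lhs => rw [← hq]
      rw [push_apply, push_apply]
      refine Finset.sum_congr rfl fun u _ => ?_
      by_cases hu : u ∈ D
      · have : P u t = 0 := by
          by_contra hne
          exact ht (hD u hu t ((h.nonneg u t).lt_of_ne' hne))
        simp [this]
      · simp [hu]
  by_contra hsD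
  have := h.pos_of_reflTransGen hpv hv0 (s := s) (by simpa [hv, hsD] using hs) hss
  simp [hv, hs'] at this

end IsMarkovChain

/-! ### Limiting distributions: support, potentials, identification by flows -/

namespace IsMarkovChain

variable {S : Type*} [Fintype S] {P : S → S → ℝ} {β : S → ℝ}

theorem sum_push_filter (P : S → S → ℝ) (v : S → ℝ) (C : Finset S) :
    ∑ s' ∈ C, push P v s' = ∑ s, v s * ∑ s' ∈ C, P s s' := by
  simp only [push_apply, Finset.mul_sum]
  exact Finset.sum_comm

theorem sum_row_of_closed (h : IsMarkovChain P β) {C : Finset S} {s : S}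
    (hC : ∀ s', 0 < P s s' → s' ∈ C) : ∑ s' ∈ C, P s s' = 1 := by
  rw [← h.row_sum s]
  refine Finset.sum_subset (Finset.subset_univ _) fun t _ ht => ?_
  by_contra hne
  exact ht (hC t ((h.nonneg s t).lt_of_ne' hne))

theorem exists_law_pos_of_limit_pos (h : IsMarkovChain P β) {p : S → ℝ}
    (hp : Tendsto (timeAvg P β) atTop (𝓝 p)) {s : S} (hs : 0 < p s) :
    ∃ s₀, 0 < β s₀ ∧ Relation.ReflTransGen (fun s s' => 0 < P s s') s₀ s := by
  by_contra hne
  have hz : ∀ t, law P β t s = 0 := fun t => by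
    by_contra h0
    exact hne (h.exists_reflTransGen_of_law_pos ((h.law_nonneg t s).lt_of_ne' h0))
  have h0 : Tendsto (fun n => timeAvg P β n s) atTop (𝓝 0) := by simp [timeAvg, hz]
  exact hs.ne' (tendsto_nhds_unique (tendsto_pi_nhds.1 hp s) h0)

/-- The limiting distribution charges exactly the recurrent states. -/
theorem limit_pos_iff (h : IsMarkovChain P β) {p : S → ℝ}
    (hp : Tendsto (timeAvg P β) atTop (𝓝 p)) {s : S} :
    0 < p s ↔ s ∈ tsccUnion (fun s s' => 0 < P s s') β := by
  classical
  obtain ⟨hst, hp0, -⟩ := h.stationary_of_tendsto le_rfl hp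
  constructor
  · intro hs
    obtain ⟨s₀, h0, h1⟩ := h.exists_law_pos_of_limit_pos hp hs
    obtain ⟨t, ht, hst'⟩ := exists_reflTransGen_mem_tsccUnion h0 h1
    exact h.mem_of_reflTransGen hst hp0
      (fun u hu v huv => mem_tsccUnion_of_reflTransGen hu (.single huv)) hs hst' ht
  · intro hs
    obtain ⟨⟨s₀, h0, h1⟩, hrec⟩ := mem_tsccUnion_iff.1 hs
    obtain ⟨t₀, ht₀⟩ := h.exists_law_pos_of_reflTransGen h0 h1
    set C : Finset S :=
      Finset.univ.filter fun t => Relation.ReflTransGen (fun s s' => 0 < P s s') s t with hC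
    -- Mass never leaves the closed class `C`, so its mass increases to a limit that is also the
    -- Cesàro limit, whatever the period of the chain.
    have hmono : Monotone fun t => ∑ u ∈ C, law P β t u := by
      refine monotone_nat_of_le_succ fun t => ?_
      rw [law_succ, sum_push_filter, ← Finset.sum_filter_add_sum_filter_not Finset.univ (· ∈ C)]
      have h1 : ∑ u ∈ Finset.univ.filter (· ∈ C), law P β t u * ∑ s' ∈ C, P u s' =
          ∑ u ∈ C, law P β t u := by
        rw [Finset.filter_mem_eq_inter, Finset.univ_inter]
        refine Finset.sum_congr rfl fun u hu => ?_
        rw [h.sum_row_of_closed, mul_one]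
        intro v huv
        simp only [hC, Finset.mem_filter, Finset.mem_univ, true_and] at hu ⊢
        exact hu.tail huv
      rw [h1]
      exact le_add_of_nonneg_right (Finset.sum_nonneg fun u _ =>
        mul_nonneg (h.law_nonneg t u) (Finset.sum_nonneg fun _ _ => h.nonneg _ _))
    have hsC : s ∈ C := by simp [hC, Relation.ReflTransGen.refl]
    have hpC : 0 < ∑ u ∈ C, p u := by
      have hc : 0 < ∑ u ∈ C, law P β t₀ u :=
        ht₀.trans_le (Finset.single_le_sum (fun i _ => h.law_nonneg t₀ i) hsC)
      set c := ∑ u ∈ C, law P β t₀ u with hcdef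
      have hlaw : Tendsto (fun t => ∑ u ∈ C, law P β t u) atTop
          (𝓝 (⨆ t, ∑ u ∈ C, law P β t u)) := by
        refine tendsto_atTop_ciSup hmono ⟨1, ?_⟩
        rintro _ ⟨t, rfl⟩
        rw [← h.sum_law t]
        exact Finset.sum_le_sum_of_subset_of_nonneg (Finset.subset_univ _)
          fun i _ _ => h.law_nonneg t i
      have hge : c ≤ ⨆ t, ∑ u ∈ C, law P β t u := hmono.ge_of_tendsto hlaw t₀
      have hav : Tendsto (fun n => ∑ u ∈ C, timeAvg P β n u) atTop (𝓝 (∑ u ∈ C, p u)) :=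
        tendsto_finsetSum _ fun u _ => tendsto_pi_nhds.1 hp u
      have hces : Tendsto (fun n => ∑ u ∈ C, timeAvg P β n u) atTop
          (𝓝 (⨆ t, ∑ u ∈ C, law P β t u)) := by
        -- The shift matches averages over times 1 to n with Cesàro means indexed from 0.
        have := ((tendsto_add_atTop_iff_nat 1).2 hlaw).cesaro
        refine this.congr fun n => ?_
        rw [sum_timeAvg, one_div, Finset.range_eq_Ico,
          Finset.sum_Ico_add' (fun t => ∑ u ∈ C, law P β t u) 0 n 1]
        rfl
      rw [tendsto_nhds_unique hav hces]
      exact hc.trans_le hge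
    obtain ⟨u, hu, hpu⟩ := Finset.exists_lt_of_sum_lt (s := C) (f := fun _ : S => (0 : ℝ))
      (by simpa using hpC)
    simp only [hC, Finset.mem_filter, Finset.mem_univ, true_and] at hu
    exact h.pos_of_reflTransGen hst hp0 hpu (hrec u hu)

theorem limit_eq_zero (h : IsMarkovChain P β) {p : S → ℝ}
    (hp : Tendsto (timeAvg P β) atTop (𝓝 p)) {s : S}
    (hs : s ∉ tsccUnion (fun s s' => 0 < P s s') β) : p s = 0 := by
  obtain ⟨-, hp0, -⟩ := h.stationary_of_tendsto le_rfl hp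
  by_contra hne
  exact hs ((h.limit_pos_iff hp).1 ((hp0 s).lt_of_ne' hne))

/-- The potential equation `y = y P + β - p` has a solution supported on the reachable states. -/
theorem exists_potential (h : IsMarkovChain P β) {p : S → ℝ}
    (hp : Tendsto (timeAvg P β) atTop (𝓝 p)) :
    ∃ y : S → ℝ, (∀ s, ¬ (∃ s₀, 0 < β s₀ ∧
      Relation.ReflTransGen (fun s s' => 0 < P s s') s₀ s) → y s = 0) ∧
      y - push P y = β - p := by
  -- Each β - βPᵗ telescopes into the image `W` of `V` under I - P, hence so do their averages; `W`
  -- is closed by finite dimension and so contains β - p.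
  let V : Submodule ℝ (S → ℝ) :=
    { carrier := {z | ∀ s, ¬ (∃ s₀, 0 < β s₀ ∧
        Relation.ReflTransGen (fun s s' => 0 < P s s') s₀ s) → z s = 0}
      add_mem' := fun {a b} ha hb s hs => by simp [ha s hs, hb s hs]
      zero_mem' := fun s _ => rfl
      smul_mem' := fun c a ha s hs => by simp [ha s hs] }
  let W : Submodule ℝ (S → ℝ) := V.map (LinearMap.id - push P : (S → ℝ) →ₗ[ℝ] (S → ℝ))
  have hlawV : ∀ t, law P β t ∈ V := fun t s hs => by
    by_contra hne
    exact hs (h.exists_reflTransGen_of_law_pos ((h.law_nonneg t s).lt_of_ne' hne))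
  have hlaw : ∀ t, β - law P β t ∈ W := fun t => by
    induction t with
    | zero => simp
    | succ t ih =>
      have : β - law P β (t + 1) = (β - law P β t) +
          (LinearMap.id - push P : (S → ℝ) →ₗ[ℝ] (S → ℝ)) (law P β t) := by
        rw [law_succ]; simp
      rw [this]
      exact W.add_mem ih (Submodule.mem_map_of_mem (hlawV t))
  have havg : ∀ᶠ n in atTop, β - timeAvg P β n ∈ W := by
    filter_upwards [eventually_ge_atTop 1] with n hn
    have hn' : (n : ℝ) ≠ 0 := by positivity
    have : β - timeAvg P β n = (1 / (n : ℝ)) • ∑ t ∈ Finset.Icc 1 n, (β - law P β t) := by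
      ext s
      simp [timeAvg, mul_sub, hn']
    rw [this]
    exact W.smul_mem _ (W.sum_mem fun t _ => hlaw t)
  have hmem : β - p ∈ W :=
    (Submodule.closed_of_finiteDimensional W).mem_of_tendsto (tendsto_const_nhds.sub hp) havg
  obtain ⟨y, hy, hyp⟩ := hmem
  exact ⟨y, hy, by simpa using hyp⟩

/-- The potential equation `y = y P + β - p` has a nonnegative solution. -/
theorem exists_nonneg_potential (h : IsMarkovChain P β) {p : S → ℝ}
    (hp : Tendsto (timeAvg P β) atTop (𝓝 p)) :
    ∃ y : S → ℝ, (∀ s, 0 ≤ y s) ∧ y - push P y = β - p := by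
  classical
  obtain ⟨hst, hp0, -⟩ := h.stationary_of_tendsto le_rfl hp
  obtain ⟨z, hzV, hz⟩ := h.exists_potential hp
  set r := tsccUnion (fun s s' => 0 < P s s') β with hr
  have hcl : ∀ u ∈ r, ∀ v, 0 < P u v → v ∈ r :=
    fun u hu v huv => mem_tsccUnion_of_reflTransGen hu (.single huv)
  -- The negative part of `z` off `r` is subinvariant, because p = 0 ≤ β there, hence invariant. It
  -- cannot charge reachable states outside `r`, and `z` vanishes at unreachable ones, so z ≥ 0 off
  -- `r`.
  set w : S → ℝ := fun s => if s ∈ r then 0 else max (-z s) 0 with hw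
  have hw0 : ∀ s, 0 ≤ w s := fun s => by
    simp only [hw]; split_ifs
    exacts [le_rfl, le_max_right _ _]
  have hwst : push P w = w := h.push_eq_of_le fun t => by
    by_cases ht : t ∈ r
    · simpa [hw, ht] using h.push_nonneg hw0 t
    · simp only [hw, ht, if_false]
      refine max_le ?_ (h.push_nonneg hw0 t)
      have hzt := congrFun hz t
      simp only [Pi.sub_apply, h.limit_eq_zero hp ht] at hzt
      have : -push P z t ≤ push P w t := by
        rw [push_apply, push_apply, ← Finset.sum_neg_distrib]
        refine Finset.sum_le_sum fun u _ => ?_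
        by_cases hu : u ∈ r
        · have : P u t = 0 := by
            by_contra hne
            exact ht (hcl u hu t ((h.nonneg u t).lt_of_ne' hne))
          simp [this]
        · rw [← neg_mul]
          refine mul_le_mul_of_nonneg_right ?_ (h.nonneg _ _)
          simp [hw, hu]
      change -z t ≤ push P w t
      linarith [h.init_nonneg t]
  have hznn : ∀ s, s ∉ r → 0 ≤ z s := fun s hs => by
    by_contra hneg
    have hws : 0 < w s := by simp only [hw, hs, if_false]; exact lt_max_of_lt_left (by linarith)
    have hreach : ∃ s₀, 0 < β s₀ ∧ Relation.ReflTransGen (fun s s' => 0 < P s s') s₀ s := by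
      by_contra hne
      exact hneg (hzV s hne).ge
    obtain ⟨s₀, h0, h1⟩ := hreach
    obtain ⟨t, ht, hst'⟩ := exists_reflTransGen_mem_tsccUnion h0 h1
    exact hs (h.mem_of_reflTransGen hwst hw0 hcl hws hst' ht)
  -- On `r`, adding a multiple of the invariant `p`, positive there, repairs the sign without
  -- changing the equation.
  obtain ⟨c, hc⟩ : ∃ c : ℝ, ∀ s, s ∈ r → -z s ≤ c * p s := by
    refine ⟨∑ s, |z s| / p s, fun s hs => ?_⟩
    have hps := (h.limit_pos_iff hp).2 hs
    refine (neg_le_abs (z s)).trans ?_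
    rw [← div_le_iff₀ hps]
    exact Finset.single_le_sum (f := fun s => |z s| / p s)
      (fun i _ => div_nonneg (abs_nonneg _) (hp0 i)) (Finset.mem_univ s)
  refine ⟨z + c • p, fun s => ?_, ?_⟩
  · by_cases hs : s ∈ r
    · have := hc s hs
      simp only [Pi.add_apply, Pi.smul_apply, smul_eq_mul]
      linarith
    · simpa [h.limit_eq_zero hp hs] using hznn s hs
  · rw [map_add, map_smul, hst, ← hz]
    abel

/-- A stationary distribution `x` supported on a closed recurrent set `r` is the limit of the time
averages as soon as a flow `w` outside of `r` carries the initial distribution into the components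
of `r` with the masses given by `x`. -/
theorem tendsto_timeAvg_of_flow (h : IsMarkovChain P β) {r : Set S} {x w : S → ℝ}
    (hcl : ∀ s ∈ r, ∀ s', 0 < P s s' → s' ∈ r)
    (hrec : ∀ s ∈ r, ∀ s', Relation.ReflTransGen (fun s s' => 0 < P s s') s s' →
      Relation.ReflTransGen (fun s s' => 0 < P s s') s' s)
    (hx : push P x = x) (hxpos : ∀ s ∈ r, 0 < x s) (hx0 : ∀ s ∉ r, x s = 0)
    (hxsum : ∑ s, x s = 1) (hw0 : ∀ s, 0 ≤ w s)
    (hwN : ∀ s ∉ r, β s + push P w s ≤ w s)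
    (hwC : ∀ s ∈ r, ∀ C : Finset S,
      (∀ t, t ∈ C ↔ Relation.ReflTransGen (fun s s' => 0 < P s s') s t) →
        ∑ t ∈ C, (β t + push P w t) ≤ ∑ t ∈ C, x t) :
    Tendsto (timeAvg P β) atTop (𝓝 x) := by
  classical
  -- `Z t s` is the expected number of visits before time `t` to a state outside `r`; the
  -- supersolution `w` dominates it by induction.
  set Z : ℕ → S → ℝ := fun t s => if s ∈ r then 0 else ∑ k ∈ Finset.range t, law P β k s with hZ
  have hZw : ∀ t s, Z t s ≤ w s := by
    intro t
    induction t with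
    | zero => intro s; simpa [hZ] using hw0 s
    | succ t ih =>
      intro s
      by_cases hs : s ∈ r
      · simpa [hZ, hs] using hw0 s
      · refine le_trans ?_ (hwN s hs)
        simp only [hZ, hs, if_false]
        rw [Finset.sum_range_succ', law_zero, add_comm]
        gcongr
        simp only [law_succ, push_apply]
        rw [Finset.sum_comm]
        refine Finset.sum_le_sum fun u _ => ?_
        rw [← Finset.sum_mul]
        by_cases hu : u ∈ r
        · have : P u s = 0 := by
            by_contra hne
            exact hs (hcl u hu s ((h.nonneg u s).lt_of_ne' hne))
          simp [this]
        · refine mul_le_mul_of_nonneg_right ?_ (h.nonneg _ _)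
          simpa [hZ, hu] using ih u
  have hlawC : ∀ s ∈ r, ∀ C : Finset S,
      (∀ t, t ∈ C ↔ Relation.ReflTransGen (fun s s' => 0 < P s s') s t) →
        ∀ t, ∑ u ∈ C, law P β t u ≤ ∑ u ∈ C, x u := by
    intro s hs C hC t
    have hCr : ∀ u ∈ C, u ∈ r := fun u hu => by
      have := (hC u).1 hu
      clear hu
      induction this with
      | refl => exact hs
      | tail _ huv ih => exact hcl _ ih _ huv
    -- The mass of `C` at time `t` is its initial mass plus all that has entered from outside `r`:
    -- nothing leaves `C`, and no other component feeds it.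
    have heq : ∑ u ∈ C, law P β t u = ∑ u ∈ C, (β u + push P (Z t) u) := by
      induction t with
      | zero => simp [hZ, push_apply]
      | succ t ih =>
        rw [Finset.sum_add_distrib, sum_push_filter] at ih ⊢
        rw [law_succ, sum_push_filter]
        have hstep : ∀ u, law P β t u * ∑ s' ∈ C, P u s' =
            (if u ∈ C then law P β t u else 0) + (Z (t + 1) u - Z t u) * ∑ s' ∈ C, P u s' := by
          intro u
          by_cases hu : u ∈ r
          · by_cases huC : u ∈ C
            · have : ∑ s' ∈ C, P u s' = 1 := h.sum_row_of_closed fun v huv =>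
                (hC v).2 (((hC u).1 huC).tail huv)
              simp [hZ, hu, huC, this]
            · have : ∑ s' ∈ C, P u s' = 0 := Finset.sum_eq_zero fun v hv => by
                by_contra hne
                have huv : 0 < P u v := (h.nonneg u v).lt_of_ne' hne
                exact huC ((hC u).2 (((hC v).1 hv).trans (hrec u hu v (.single huv))))
              simp [hZ, hu, huC, this]
          · have huC : u ∉ C := fun hc => hu (hCr u hc)
            simp [hZ, hu, huC, Finset.sum_range_succ]
        rw [Finset.sum_congr rfl fun u _ => hstep u, Finset.sum_add_distrib]
        simp only [sub_mul, Finset.sum_sub_distrib]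
        rw [← Finset.sum_filter, Finset.filter_mem_eq_inter, Finset.univ_inter, ih]
        ring
    rw [heq]
    refine le_trans (Finset.sum_le_sum fun u _ => ?_) (hwC s hs C hC)
    gcongr
    rw [push_apply, push_apply]
    exact Finset.sum_le_sum fun v _ => mul_le_mul_of_nonneg_right (hZw t v) (h.nonneg _ _)
  -- By compactness it suffices that every cluster point `q` of the averages is `x`.
  refine (isCompact_univ_pi fun _ : S => isCompact_Icc (a := (0 : ℝ)) (b := 1)
    ).tendsto_nhds_of_unique_mapClusterPt ?_ ?_
  · filter_upwards [eventually_ge_atTop 1] with n hn s _ using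
      ⟨h.timeAvg_nonneg n s, h.timeAvg_le_one hn s⟩
  · intro q _ hq
    obtain ⟨U, hU, hUq⟩ := mapClusterPt_iff_ultrafilter.1 hq
    obtain ⟨hqst, hq0, hqsum⟩ := h.stationary_of_tendsto hU hUq
    have hUq' := tendsto_pi_nhds.1 hUq
    have hqN : ∀ s ∉ r, q s = 0 := fun s hs => by
      refine le_antisymm ?_ (hq0 s)
      have h0 : Tendsto (fun n : ℕ => (1 / (n : ℝ)) * w s) U (𝓝 0) := by
        simpa using (tendsto_one_div_atTop_nhds_zero_nat.mono_left hU).mul_const (w s)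
      refine le_of_tendsto_of_tendsto' (hUq' s) h0 fun n => ?_
      refine mul_le_mul_of_nonneg_left ?_ (by positivity)
      refine le_trans (Finset.sum_le_sum_of_subset_of_nonneg (t := Finset.range (n + 1)) ?_
        fun i _ _ => h.law_nonneg i s) (by simpa [hZ, hs] using hZw (n + 1) s)
      intro k hk
      rw [Finset.mem_Icc] at hk
      rw [Finset.mem_range]
      omega
    have hqC : ∀ s ∈ r, ∀ C : Finset S,
        (∀ t, t ∈ C ↔ Relation.ReflTransGen (fun s s' => 0 < P s s') s t) →
          ∑ u ∈ C, q u ≤ ∑ u ∈ C, x u := fun s hs C hC => by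
      refine le_of_tendsto (tendsto_finsetSum C fun u _ => hUq' u) ?_
      filter_upwards [hU (eventually_ge_atTop 1)] with n hn
      rw [sum_timeAvg]
      exact average_le hn (hlawC s hs C hC)
    have hle : ∀ s, q s ≤ x s := by
      intro s
      by_cases hs : s ∈ r
      swap
      · rw [hqN s hs, hx0 s hs]
      -- At a maximum of q/x, with value `c`, the invariant vector cx - q ≥ 0 vanishes, hence
      -- vanishes on the whole class of `m`. The mass bound on that class then forces c ≤ 1, that
      -- is, q ≤ x everywhere.
      obtain ⟨m, hm, hmax⟩ := Set.exists_max_image r (fun s => q s / x s) (Set.toFinite r) ⟨s, hs⟩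
      set c := q m / x m with hc
      have hv0 : ∀ t, 0 ≤ (c • x - q) t := fun t => by
        simp only [Pi.sub_apply, Pi.smul_apply, smul_eq_mul, sub_nonneg]
        by_cases ht : t ∈ r
        · exact (div_le_iff₀ (hxpos t ht)).1 (hmax t ht)
        · rw [hqN t ht, hx0 t ht, mul_zero]
      have hvst : push P (c • x - q) = c • x - q := by rw [map_sub, map_smul, hx, hqst]
      have hvm : (c • x - q) m = 0 := by
        simp [hc, div_mul_cancel₀ _ (hxpos m hm).ne']
      set C : Finset S :=
        Finset.univ.filter fun t => Relation.ReflTransGen (fun s s' => 0 < P s s') m t with hCdef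
      have hC : ∀ t, t ∈ C ↔ Relation.ReflTransGen (fun s s' => 0 < P s s') m t := by simp [hCdef]
      have hqx : ∀ t ∈ C, c * x t = q t := fun t ht => by
        by_contra hne
        have : 0 < (c • x - q) t := (hv0 t).lt_of_ne' (by simpa [sub_eq_zero] using hne)
        have := h.pos_of_reflTransGen hvst hv0 this (hrec m hm t ((hC t).1 ht))
        exact this.ne' hvm
      have hxC : 0 < ∑ t ∈ C, x t :=
        (hxpos m hm).trans_le (Finset.single_le_sum (fun t _ => by
          by_cases ht : t ∈ r
          exacts [(hxpos t ht).le, (hx0 t ht).ge]) ((hC m).2 .refl))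
      have hc1 : c ≤ 1 := by
        have := hqC m hm C hC
        rw [← Finset.sum_congr rfl hqx, ← Finset.mul_sum] at this
        exact le_of_mul_le_mul_right (by simpa using this) hxC
      have := (div_le_iff₀ (hxpos s hs)).1 ((hmax s hs).trans hc1)
      simpa using this
    exact funext fun s => ((Finset.sum_eq_sum_iff_of_le fun i _ => hle i).1
      (hqsum.trans hxsum.symm)) s (Finset.mem_univ s)

end IsMarkovChain

/-! ### Chains induced by policies and their occupation measures -/

namespace MDP

variable {S A : Type*} [Fintype S] {M : MDP S A} {π p x y : S → A → ℝ}

theorem IsStationaryPolicy.isMarkovChain (hπ : M.IsStationaryPolicy π) :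
    IsMarkovChain (M.chainTrans π) M.init where
  nonneg s s' := Finset.sum_nonneg fun a ha => mul_nonneg (M.trans_nonneg s a ha s') (hπ.nonneg s a)
  row_sum s := by
    simp only [chainTrans]
    rw [Finset.sum_comm]
    simp only [← Finset.sum_mul]
    rw [Finset.sum_congr rfl fun a ha => by rw [M.trans_sum s a ha, one_mul], hπ.sum_eq_one]
  init_nonneg := M.init_nonneg
  init_sum := M.init_sum

theorem stateProb_eq_law (M : MDP S A) (π : S → A → ℝ) (t : ℕ) :
    M.stateProb π t = IsMarkovChain.law (M.chainTrans π) M.init t := by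
  induction t with
  | zero => rfl
  | succ t ih => rw [IsMarkovChain.law_succ, ← ih]; rfl

theorem average_stateActionProb (M : MDP S A) (π : S → A → ℝ) (n : ℕ) (s : S) (a : A) :
    (1 / (n : ℝ)) * ∑ t ∈ Finset.Icc 1 n, M.stateActionProb π t s a =
      IsMarkovChain.timeAvg (M.chainTrans π) M.init n s * π s a := by
  simp only [stateActionProb, stateProb_eq_law, IsMarkovChain.timeAvg]
  rw [← Finset.sum_mul, mul_assoc]

theorem isSteadyState_of_tendsto {q : S → ℝ}
    (hq : Tendsto (IsMarkovChain.timeAvg (M.chainTrans π) M.init) atTop (𝓝 q)) :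
    M.IsSteadyState π fun s a => q s * π s a := fun s a _ => by
  simp only [average_stateActionProb]
  exact (tendsto_pi_nhds.1 hq s).mul_const _

theorem IsSteadyState.tendsto_timeAvg (hπ : M.IsStationaryPolicy π) (hp : M.IsSteadyState π p) :
    Tendsto (IsMarkovChain.timeAvg (M.chainTrans π) M.init) atTop
      (𝓝 fun s => ∑ a ∈ M.avail s, p s a) := by
  refine tendsto_pi_nhds.2 fun s => ?_
  refine (tendsto_finsetSum (M.avail s) fun a ha => hp s a ha).congr fun n => ?_
  simp only [average_stateActionProb]
  rw [← Finset.mul_sum, hπ.sum_eq_one, mul_one]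

theorem IsSteadyState.eq_mul (hπ : M.IsStationaryPolicy π) (hp : M.IsSteadyState π p) {s : S}
    {a : A} (ha : a ∈ M.avail s) : p s a = (∑ b ∈ M.avail s, p s b) * π s a :=
  tendsto_nhds_unique (hp s a ha)
    (isSteadyState_of_tendsto (hp.tendsto_timeAvg hπ) s a ha)

theorem IsSteadyState.avgReward_eq (hp : M.IsSteadyState π p) :
    M.avgReward π = M.lpObjective p := by
  refine Tendsto.liminf_eq ?_
  have h : Tendsto (fun n : ℕ => ∑ s, ∑ a ∈ M.avail s,
      ((1 / (n : ℝ)) * ∑ t ∈ Finset.Icc 1 n, M.stateActionProb π t s a) * M.meanReward s a)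
      atTop (𝓝 (M.lpObjective p)) :=
    tendsto_finsetSum _ fun s _ => tendsto_finsetSum _ fun a ha => (hp s a ha).mul_const _
  refine h.congr fun n => ?_
  simp only [expReward, mul_assoc, ← Finset.mul_sum]
  congr 1
  rw [Finset.sum_comm]
  refine Finset.sum_congr rfl fun s _ => ?_
  rw [Finset.sum_comm]
  exact Finset.sum_congr rfl fun a _ => Finset.sum_mul _ _ _

theorem mem_recurrentSet_of_trans_pos {s s' : S} {a : A} (hs : s ∈ M.recurrentSet)
    (ha : a ∈ M.avail s) (h : 0 < M.trans s a s') : s' ∈ M.recurrentSet :=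
  mem_tsccUnion_of_reflTransGen hs (.single ⟨a, ha, h⟩)

theorem edge_of_chainTrans_pos {s s' : S} (h : 0 < M.chainTrans π s s') : M.Edge s s' := by
  by_contra hne
  simp only [Edge, not_exists, not_and] at hne
  refine h.ne' (Finset.sum_eq_zero fun a ha => ?_)
  rw [le_antisymm (not_lt.1 (hne a ha)) (M.trans_nonneg s a ha s'), zero_mul]

theorem reflTransGen_edge {s s' : S}
    (h : Relation.ReflTransGen (fun s s' => 0 < M.chainTrans π s s') s s') :
    Relation.ReflTransGen M.Edge s s' :=
  Relation.ReflTransGen.mono (fun _ _ => edge_of_chainTrans_pos) _ _ h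

theorem chainTrans_pos (hπ : M.IsStationaryPolicy π) {s s' : S} {a : A} (ha : a ∈ M.avail s)
    (hpos : 0 < π s a) (h : 0 < M.trans s a s') : 0 < M.chainTrans π s s' :=
  (mul_pos h hpos).trans_le (Finset.single_le_sum (f := fun a => M.trans s a s' * π s a)
    (fun b hb => mul_nonneg (M.trans_nonneg s b hb s') (hπ.nonneg s b)) ha)

/-- Inside the recurrent set, paths of the MDP are paths of a chain whose policy has full support
there. -/
theorem reflTransGen_chainTrans (hπ : M.IsStationaryPolicy π)
    (hpos : ∀ s ∈ M.recurrentSet, ∀ a ∈ M.avail s, 0 < π s a) {s s' : S}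
    (hs : s ∈ M.recurrentSet) (h : Relation.ReflTransGen M.Edge s s') :
    Relation.ReflTransGen (fun s s' => 0 < M.chainTrans π s s') s s' := by
  induction h with
  | refl => exact .refl
  | @tail u v hu huv ih =>
    obtain ⟨a, ha, hT⟩ := huv
    exact ih.tail (chainTrans_pos hπ ha (hpos u (mem_tsccUnion_of_reflTransGen hs hu) a ha) hT)

theorem push_eq_sum {v : S → ℝ} {z : S → A → ℝ}
    (h : ∀ s, ∀ a ∈ M.avail s, z s a = v s * π s a) (s' : S) :
    IsMarkovChain.push (M.chainTrans π) v s' = ∑ s, ∑ a ∈ M.avail s, z s a * M.trans s a s' := by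
  rw [IsMarkovChain.push_apply]
  refine Finset.sum_congr rfl fun s _ => ?_
  rw [chainTrans, Finset.mul_sum]
  refine Finset.sum_congr rfl fun a ha => ?_
  rw [h s a ha]
  ring

/-! ### From points of `InQ0` to occupation measures -/

namespace InQ0

/-- Summing the flow constraint over all states cancels `y` and leaves the total mass of β. -/
theorem sum_x (h : M.InQ0 x y) : ∑ s, ∑ a ∈ M.avail s, x s a = 1 := by
  have h1 := Finset.sum_congr rfl fun s' (_ : s' ∈ Finset.univ) => h.flow s'
  rw [Finset.sum_comm, Finset.sum_sub_distrib, M.init_sum] at h1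
  have h2 : ∀ s, ∑ s', ∑ a ∈ M.avail s, y s a * M.trans s a s' = ∑ a ∈ M.avail s, y s a := by
    intro s
    rw [Finset.sum_comm]
    refine Finset.sum_congr rfl fun a ha => ?_
    rw [← Finset.mul_sum, M.trans_sum s a ha, mul_one]
  simp only [h2, Finset.sum_add_distrib] at h1
  linarith

theorem x_eq_zero (h : M.InQ0 x y) {s : S} (hs : s ∉ M.recurrentSet) {a : A}
    (ha : a ∈ M.avail s) : x s a = 0 := by
  classical
  have h1 := (Finset.sum_eq_zero_iff_of_nonneg (fun f _ =>
    Finset.sum_nonneg fun a ha => (h.x_mem f a ha).1)).1 h.nonrecurrent s (by simpa using hs)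
  exact (Finset.sum_eq_zero_iff_of_nonneg fun a ha => (h.x_mem s a ha).1).1 h1 a ha

theorem sum_x_nonneg (h : M.InQ0 x y) (s : S) : 0 ≤ ∑ a ∈ M.avail s, x s a :=
  Finset.sum_nonneg fun a ha => (h.x_mem s a ha).1

theorem x_eq_mul (h : M.InQ0 x y) (hπ : M.IsPolicyFrom x y π) {s : S} {a : A}
    (ha : a ∈ M.avail s) : x s a = (∑ b ∈ M.avail s, x s b) * π s a := by
  rcases (h.sum_x_nonneg s).lt_or_eq with hs | hs
  · rw [hπ.eq_x s hs a ha, mul_div_cancel₀ _ hs.ne']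
  · rw [← hs, zero_mul]
    exact (Finset.sum_eq_zero_iff_of_nonneg fun a ha => (h.x_mem s a ha).1).1 hs.symm a ha

/-- Off the recurrent set `x` vanishes, so there the policy follows `y`; on it the policy may follow
`x` and the factorization can fail. -/
theorem y_eq_mul (h : M.InQ0 x y) (hπ : M.IsPolicyFrom x y π) {s : S}
    (hs : s ∉ M.recurrentSet) {a : A} (ha : a ∈ M.avail s) :
    y s a = (∑ b ∈ M.avail s, y s b) * π s a := by
  have hx : ¬ 0 < ∑ b ∈ M.avail s, x s b := by
    rw [Finset.sum_eq_zero fun b hb => h.x_eq_zero hs hb]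
    exact lt_irrefl _
  have hy : 0 ≤ ∑ b ∈ M.avail s, y s b := Finset.sum_nonneg fun b hb => h.y_nonneg s b hb
  rcases hy.lt_or_eq with hy | hy
  · rw [hπ.eq_y s hx hy a ha, mul_div_cancel₀ _ hy.ne']
  · rw [← hy, zero_mul]
    exact (Finset.sum_eq_zero_iff_of_nonneg fun a ha => h.y_nonneg s a ha).1 hy.symm a ha

/-- Dividing by x_s ≤ 1 only increases `x`; this carries lower bounds from `x` over to the policy.
-/
theorem le_policy (h : M.InQ0 x y) (hπ : M.IsPolicyFrom x y π) {s : S} {a : A}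
    (ha : a ∈ M.avail s) : x s a ≤ π s a := by
  rw [h.x_eq_mul hπ ha]
  refine mul_le_of_le_one_left (hπ.stationaryPolicy.nonneg s a) ?_
  rw [← h.sum_x]
  exact Finset.single_le_sum (fun s _ => h.sum_x_nonneg s) (Finset.mem_univ s)

/-- The occupation measure of a policy derived from a point of `Q_0` which is positive on the
recurrent set is that point. -/
theorem tendsto_timeAvg (h : M.InQ0 x y) (hπ : M.IsPolicyFrom x y π)
    (hpos : ∀ s ∈ M.recurrentSet, ∀ a ∈ M.avail s, 0 < x s a) :
    Tendsto (IsMarkovChain.timeAvg (M.chainTrans π) M.init) atTop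
      (𝓝 fun s => ∑ a ∈ M.avail s, x s a) := by
  classical
  have hst := hπ.stationaryPolicy
  have hch := hst.isMarkovChain
  have hπpos : ∀ s ∈ M.recurrentSet, ∀ a ∈ M.avail s, 0 < π s a := fun s hs a ha =>
    (hpos s hs a ha).trans_le (h.le_policy hπ ha)
  -- Only the transient part of `y` is kept, as `y` need not be proportional to the policy on the
  -- recurrent set.
  set w : S → ℝ := fun s => if s ∈ M.recurrentSet then 0 else ∑ a ∈ M.avail s, y s a with hw
  have hy0 : ∀ s, 0 ≤ ∑ b ∈ M.avail s, y s b := fun s =>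
    Finset.sum_nonneg fun b hb => h.y_nonneg s b hb
  have hwy : ∀ s, s ∉ M.recurrentSet → ∀ s',
      w s * M.chainTrans π s s' = ∑ a ∈ M.avail s, y s a * M.trans s a s' := by
    intro s hs s'
    rw [chainTrans, Finset.mul_sum]
    refine Finset.sum_congr rfl fun a ha => ?_
    rw [h.y_eq_mul hπ hs ha]
    simp only [hw, hs, if_false]
    ring
  refine hch.tendsto_timeAvg_of_flow (r := M.recurrentSet) (w := w)
    (fun s hs s' hss => mem_tsccUnion_of_reflTransGen hs (.single (edge_of_chainTrans_pos hss)))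
    (fun s hs s' hss => ?_) (funext fun s' => ?_)
    (fun s hs => Finset.sum_pos (hpos s hs) (M.avail_nonempty s))
    (fun s hs => Finset.sum_eq_zero fun a ha => h.x_eq_zero hs ha) h.sum_x (fun s => ?_)
    (fun s hs => ?_) (fun s hs C hC => ?_)
  · have hss' := reflTransGen_edge hss
    exact reflTransGen_chainTrans hst hπpos (mem_tsccUnion_of_reflTransGen hs hss')
      ((mem_tsccUnion_iff.1 hs).2 s' hss')
  · rw [push_eq_sum (z := x) (fun s a ha => h.x_eq_mul hπ ha), h.stationary]
  · simp only [hw]; split_ifs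
    exacts [le_rfl, hy0 s]
  · have hf := h.flow s
    rw [Finset.sum_add_distrib, Finset.sum_eq_zero fun a ha => h.x_eq_zero hs ha, zero_add] at hf
    have hpw : IsMarkovChain.push (M.chainTrans π) w s =
        ∑ u, ∑ a ∈ M.avail u, y u a * M.trans u a s := by
      refine Finset.sum_congr rfl fun u _ => ?_
      by_cases hu : u ∈ M.recurrentSet
      · simp only [hw, hu, if_true, zero_mul]
        refine (Finset.sum_eq_zero fun a ha => ?_).symm
        have : M.trans u a s = 0 := by
          by_contra hne
          exact hs (mem_recurrentSet_of_trans_pos hu ha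
            ((M.trans_nonneg u a ha s).lt_of_ne' hne))
        rw [this, mul_zero]
      · exact hwy u hu s
    rw [hpw, hf]
    simp [hw, hs]
  · have hCr : ∀ u ∈ C, u ∈ M.recurrentSet := fun u hu =>
      mem_tsccUnion_of_reflTransGen hs (reflTransGen_edge ((hC u).1 hu))
    have hfC := Finset.sum_congr rfl fun s' (_ : s' ∈ C) => h.flow s'
    rw [Finset.sum_comm] at hfC
    -- In the flow constraint summed over `C`, the `y`-mass starting in the closed class `C` stays
    -- there and cancels the `y`-term on the right; what other recurrent states send is nonnegative
    -- and is dropped.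
    have hkey : ∀ u, w u * ∑ s' ∈ C, M.chainTrans π u s' +
        (if u ∈ C then ∑ a ∈ M.avail u, y u a else 0) ≤
          ∑ s' ∈ C, ∑ a ∈ M.avail u, y u a * M.trans u a s' := by
      intro u
      by_cases hu : u ∈ M.recurrentSet
      · by_cases huC : u ∈ C
        · simp only [hw, hu, huC, if_true, zero_mul, zero_add]
          rw [Finset.sum_comm]
          refine Finset.sum_le_sum fun a ha => ?_
          rw [← Finset.mul_sum, Finset.sum_subset (Finset.subset_univ C), M.trans_sum u a ha, mul_one]
          intro v _ hv
          by_contra hne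
          exact hv ((hC v).2 (((hC u).1 huC).tail (chainTrans_pos hst ha (hπpos u hu a ha)
            ((M.trans_nonneg u a ha v).lt_of_ne' hne))))
        · simp only [hw, hu, huC, if_true, if_false, zero_mul, zero_add]
          exact Finset.sum_nonneg fun v _ => Finset.sum_nonneg fun a ha =>
            mul_nonneg (h.y_nonneg u a ha) (M.trans_nonneg u a ha v)
      · have huC : u ∉ C := fun hc => hu (hCr u hc)
        simp only [huC, if_false, add_zero]
        rw [Finset.mul_sum]
        exact (Finset.sum_congr rfl fun v _ => hwy u hu v).le
    have hsum := Finset.sum_le_sum fun u (_ : u ∈ Finset.univ) => hkey u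
    rw [hfC, Finset.sum_add_distrib, ← Finset.sum_filter, Finset.filter_mem_eq_inter,
      Finset.univ_inter, ← IsMarkovChain.sum_push_filter] at hsum
    simp only [Finset.sum_add_distrib, Finset.sum_sub_distrib] at hsum ⊢
    linarith

theorem isSteadyState (h : M.InQ0 x y) (hπ : M.IsPolicyFrom x y π)
    (hpos : ∀ s ∈ M.recurrentSet, ∀ a ∈ M.avail s, 0 < x s a) : M.IsSteadyState π x :=
  fun s a ha => by
    rw [h.x_eq_mul hπ ha]
    exact isSteadyState_of_tendsto (h.tendsto_timeAvg hπ hpos) s a ha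

end InQ0

/-- The occupation measure of an edge-preserving policy extends to a point of `Q_0`. -/
theorem exists_inQ0_of_isSteadyState (hπ : M.IsStationaryPolicy π)
    (hr : M.recurrentSetOf π = M.recurrentSet) (hp : M.IsSteadyState π p) :
    ∃ y, M.InQ0 p y := by
  classical
  have hch := hπ.isMarkovChain
  have hlim := hp.tendsto_timeAvg hπ
  obtain ⟨hst, hp0, hp1⟩ := hch.stationary_of_tendsto le_rfl hlim
  obtain ⟨z, hz0, hz⟩ := hch.exists_nonneg_potential hlim
  -- Splitting the nonnegative potential among actions according to π turns its equation into the
  -- flow constraint.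
  refine ⟨fun s a => z s * π s a, fun s' => ?_, fun s' => ?_, ?_, fun s a ha => ?_,
    fun s a ha => mul_nonneg (hz0 s) (hπ.nonneg s a)⟩
  · rw [← push_eq_sum (z := p) fun s a ha => hp.eq_mul hπ ha, hst]
  · rw [← push_eq_sum fun s a _ => rfl, Finset.sum_add_distrib, ← Finset.mul_sum, hπ.sum_eq_one]
    have := congrFun hz s'
    simp only [Pi.sub_apply] at this
    linarith
  · refine Finset.sum_eq_zero fun s hs => hch.limit_eq_zero hlim ?_
    change s ∉ M.recurrentSetOf π
    rw [hr]
    simpa using hs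
  · have hle : (∑ b ∈ M.avail s, p s b) ≤ 1 := by
      rw [← hp1]
      exact Finset.single_le_sum (fun s _ => hp0 s) (Finset.mem_univ s)
    have hπ1 : π s a ≤ 1 := by
      rw [← hπ.sum_eq_one s]
      exact Finset.single_le_sum (fun b _ => hπ.nonneg s b) ha
    rw [hp.eq_mul hπ ha]
    exact ⟨mul_nonneg (hp0 s) (hπ.nonneg s a), mul_le_one₀ hle (hπ.nonneg s a) hπ1⟩

theorem lpObjective_le {x y : S → A → ℝ} (h : M.InQ0 x y) :
    M.lpObjective x ≤ ∑ s, ∑ a ∈ M.avail s, |M.meanReward s a| := by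
  refine Finset.sum_le_sum fun s _ => Finset.sum_le_sum fun a ha => ?_
  calc x s a * M.meanReward s a ≤ x s a * |M.meanReward s a| :=
        mul_le_mul_of_nonneg_left (le_abs_self _) (h.x_mem s a ha).1
    _ ≤ |M.meanReward s a| := mul_le_of_le_one_left (abs_nonneg _) (h.x_mem s a ha).2

end MDP

/-! ### Feasible points versus admissible policies -/

namespace LMDP

variable {S A : Type*} [Fintype S] {M : LMDP S A} {δ : ℝ} {x y π : S → A → ℝ}

theorem IsFeasible.mono {δ' : ℝ} (h : M.IsFeasible δ x y) (hδ : δ' ≤ δ) : M.IsFeasible δ' x y :=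
  ⟨h.inQ0, h.specs, fun s hs a ha => hδ.trans (h.bounded s hs a ha)⟩

theorem IsFeasible.isSteadyState (hδ : 0 < δ) (h : M.IsFeasible δ x y)
    (hπ : M.IsPolicyFrom x y π) : M.IsSteadyState π x :=
  h.inQ0.isSteadyState hπ fun s hs a ha => hδ.trans_le (h.bounded s hs a ha)

/-- The recurrent states of the chain are the support of its limiting distribution, which is the
state marginal of `x`, positive exactly on r(M). -/
theorem IsFeasible.mem_edgePreservingBdd (hδ : 0 < δ) (h : M.IsFeasible δ x y)
    (hπ : M.IsPolicyFrom x y π) : π ∈ M.edgePreservingBdd δ := by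
  have hpos : ∀ s ∈ M.recurrentSet, ∀ a ∈ M.avail s, 0 < x s a := fun s hs a ha =>
    hδ.trans_le (h.bounded s hs a ha)
  refine ⟨hπ.stationaryPolicy, Set.ext fun s => ?_, fun s hs a ha =>
    (h.bounded s hs a ha).trans (h.inQ0.le_policy hπ ha)⟩
  rw [MDP.recurrentSetOf, ← hπ.stationaryPolicy.isMarkovChain.limit_pos_iff
    (h.inQ0.tendsto_timeAvg hπ hpos)]
  refine ⟨fun hs => ?_, fun hs => Finset.sum_pos (hpos s hs) (M.avail_nonempty s)⟩
  by_contra hsr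
  exact hs.ne' (Finset.sum_eq_zero fun a ha => h.inQ0.x_eq_zero hsr ha)

theorem IsFeasible.lpObjective_mem_admissibleRewards (hδ : 0 < δ) (h : M.IsFeasible δ x y)
    (hπ : M.IsPolicyFrom x y π) : M.lpObjective x ∈ M.admissibleRewards δ :=
  ⟨π, ⟨h.mem_edgePreservingBdd hδ hπ, x, h.isSteadyState hδ hπ, h.specs⟩,
    (h.isSteadyState hδ hπ).avgReward_eq⟩

/-- Admissible rewards are objective values of linear programs with smaller lower bounds. -/
theorem exists_isFeasible_of_mem_admissibleRewards (hδ : 0 < δ) {ρ : ℝ}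
    (hρ : ρ ∈ M.admissibleRewards δ) :
    ∃ ε > 0, ∃ x y, M.IsFeasible ε x y ∧ M.lpObjective x = ρ := by
  obtain ⟨π, ⟨⟨hπ, hr, hb⟩, p, hp, hspec⟩, rfl⟩ := hρ
  obtain ⟨y, hy⟩ := MDP.exists_inQ0_of_isSteadyState hπ hr hp
  have hpos : ∀ s ∈ M.recurrentSet, 0 < ∑ a ∈ M.avail s, p s a := fun s hs => by
    rw [hπ.isMarkovChain.limit_pos_iff (hp.tendsto_timeAvg hπ)]
    change s ∈ M.recurrentSetOf π
    rwa [hr]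
  -- `c` is the least stationary mass of a recurrent state, so p = p_s π ≥ cδ on recurrent pairs.
  obtain ⟨c, hc0, hc⟩ : ∃ c : ℝ, 0 < c ∧ ∀ s ∈ M.recurrentSet, c ≤ ∑ a ∈ M.avail s, p s a := by
    rcases M.recurrentSet.eq_empty_or_nonempty with he | hne
    · exact ⟨1, one_pos, by simp [he]⟩
    · obtain ⟨m, hm, hmin⟩ := Set.exists_min_image M.recurrentSet
        (fun s => ∑ a ∈ M.avail s, p s a) (Set.toFinite _) hne
      exact ⟨_, hpos m hm, hmin⟩
  refine ⟨c * δ, mul_pos hc0 hδ, p, y, ⟨hy, hspec, fun s hs a ha => ?_⟩, hp.avgReward_eq.symm⟩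
  rw [hp.eq_mul hπ ha]
  exact mul_le_mul (hc s hs) (hb s hs a ha) hδ.le (hpos s hs).le

end LMDP

theorem mainTheorem8 {S A : Type*} [Fintype S] (M : LMDP S A) :
    (∀ δ : ℝ, 0 < δ → ∀ x y π : S → A → ℝ,
      M.IsFeasible δ x y → M.IsPolicyFrom x y π → π ∈ M.edgePreservingBdd δ) ∧
    (∀ x y π : ℝ → S → A → ℝ,
      (∀ᶠ δ in 𝓝[>] (0 : ℝ), M.IsOptimal δ (x δ) (y δ) ∧ M.IsPolicyFrom (x δ) (y δ) (π δ)) →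
      (∀ᶠ δ in 𝓝[>] (0 : ℝ),
        (M.admissibleRewards δ).Nonempty ∧ BddAbove (M.admissibleRewards δ)) ∧
      Tendsto (fun δ => sSup (M.admissibleRewards δ) - M.avgReward (π δ))
        (𝓝[>] (0 : ℝ)) (𝓝 0)) := by
  refine ⟨fun δ hδ x y π hf hπ => hf.mem_edgePreservingBdd hδ hπ, fun x y π hev => ?_⟩
  obtain ⟨δ₀, hδ₀, hopt⟩ := mem_nhdsGT_iff_exists_Ioo_subset.1 hev
  rw [Set.mem_Ioi] at hδ₀
  have hδ₀mem : Set.Ioo 0 δ₀ ∈ 𝓝[>] (0 : ℝ) := Ioo_mem_nhdsGT hδ₀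
  -- The supremum of these optimal values is their limit as δ → 0⁺, and it bounds every admissible
  -- reward.
  set V : Set ℝ := (fun δ => M.lpObjective (x δ)) '' Set.Ioo 0 δ₀ with hV
  have hVbdd : BddAbove V := ⟨_, by
    rintro _ ⟨δ, hδ, rfl⟩
    exact MDP.lpObjective_le (hopt hδ).1.1.inQ0⟩
  have hVne : V.Nonempty := ⟨_, δ₀ / 2, ⟨half_pos hδ₀, half_lt_self hδ₀⟩, rfl⟩
  have hub : ∀ δ, 0 < δ → ∀ ρ ∈ M.admissibleRewards δ, ρ ≤ sSup V := by
    intro δ hδ ρ hρ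
    obtain ⟨ε, hε, x', y', hf, rfl⟩ := LMDP.exists_isFeasible_of_mem_admissibleRewards hδ hρ
    -- Shrinking the parameter keeps feasibility and reaches the range where optima are given.
    have hmem : min ε (δ₀ / 2) ∈ Set.Ioo 0 δ₀ :=
      ⟨lt_min hε (half_pos hδ₀), (min_le_right _ _).trans_lt (half_lt_self hδ₀)⟩
    exact ((hopt hmem).1.2 x' y' (hf.mono (min_le_left _ _))).trans
      (le_csSup hVbdd ⟨_, hmem, rfl⟩)
  have hmemV : ∀ δ ∈ Set.Ioo 0 δ₀, M.lpObjective (x δ) ∈ M.admissibleRewards δ := fun δ hδ =>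
    (hopt hδ).1.1.lpObjective_mem_admissibleRewards hδ.1 (hopt hδ).2
  have hbdd : ∀ δ ∈ Set.Ioo 0 δ₀, BddAbove (M.admissibleRewards δ) := fun δ hδ =>
    ⟨sSup V, hub δ hδ.1⟩
  refine ⟨?_, ?_⟩
  · filter_upwards [hδ₀mem] with δ hδ using ⟨⟨_, hmemV δ hδ⟩, hbdd δ hδ⟩
  · rw [Metric.tendsto_nhds]
    intro ε hε
    -- For δ < δ₁, both the optimal value and the supremum of admissible rewards lie between the
    -- value at δ₁ and `sSup V`.
    obtain ⟨_, ⟨δ₁, hδ₁, rfl⟩, hlt⟩ := exists_lt_of_lt_csSup hVne (sub_lt_self (sSup V) hε)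
    filter_upwards [hδ₀mem, Ioo_mem_nhdsGT hδ₁.1] with δ hδ hδ'
    have h1 : M.lpObjective (x δ₁) ≤ M.lpObjective (x δ) :=
      (hopt hδ).1.2 _ _ ((hopt hδ₁).1.1.mono hδ'.2.le)
    have h2 : M.lpObjective (x δ) ≤ sSup (M.admissibleRewards δ) :=
      le_csSup (hbdd δ hδ) (hmemV δ hδ)
    have h3 : sSup (M.admissibleRewards δ) ≤ sSup V :=
      csSup_le ⟨_, hmemV δ hδ⟩ (hub δ hδ.1)
    rw [((hopt hδ).1.1.isSteadyState hδ.1 (hopt hδ).2).avgReward_eq, dist_zero_right,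
      Real.norm_eq_abs, abs_lt]
    constructor <;> linarith
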